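/- Let $L$ be a frame with least element $0$, greatest element $1$ and implication $\to$. An $L$-subset of a set $X$ is a map $A:X\to L$; it is nonempty if $\bigvee_{x}A(x)=1$. Put $\mathrm{sub}(A,B)=\bigwedge_{x}(A(x)\to B(x))$, and, for $f:X\to Y$, $f^{\to}(A)(y)=\bigvee_{f(x)=y}A(x)$. **Spaces.** An $L$-topology on $X$ is a family $\mathcal O(X)\subseteq L^X$ (the open sets) closed under binary meets and arbitrary joins and containing all constant maps $a_X$ ($a\in L$). A map $f$ is continuous if $B\circ f$ is open for every open $B$. Write $A^\circ=\bigvee\{B\in\mathcal O(X): B\le A\}$. A point of $\mathcal O(X)$ is a map $p:\mathcal O(X)\to L$ with $p(A\wedge B)=p(A)\wedge p(B)$, $p(\bigvee_i A_i)=\bigvee_i p(A_i)$ and $p(a_X)=a$ for $a\in L$. The space $X$ is $L$-sober if $x\mapsto[x]$, $[x](A)=A(x)$, is a bijection from $X$ onto the set of points of $\mathcal O(X)$. An $L$-subset $A$ is super-compact if it is nonempty and $\mathrm{sub}(A,\bigvee_i V_i)=\bigvee_i\mathrm{sub}(A,V_i)$ for every family $(V_i)$ of open sets. The space $X$ is locally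 super-compact if $A=\bigvee_{B\text{ super-compact}}\mathrm{sub}(B,A)\wedge B^\circ$ for every open $A$. **Orders.** An $L$-order on $P$ is a map $e:P\times P\to L$ with $e(x,x)=1$, $e(x,y)\wedge e(y,z)\le e(x,z)$, and $x=y$ whenever $e(x,y)\wedge e(y,x)=1$. An element $s$ is the supremum $\sqcup A$ of $A\in L^P$ if $e(s,y)=\bigwedge_x(A(x)\to e(x,y))$ for all $y$. An $L$-subset $D$ is directed if it is nonempty and $D(x)\wedge D(y)\le\bigvee_z D(z)\wedge e(x,z)\wedge e(y,z)$ for all $x,y$. $P$ is an $L$-dcpo if every directed $L$-subset has a supremum. Let $\Downarrow\! x\,(y)=\bigwedge_D\big(e(x,\sqcup D)\to\bigvee_d D(d)\wedge e(y,d)\big)$, where $D$ runs over the directed $L$-subsets that have a supremum. $P$ is continuous if, for every $x$, $\Downarrow\! x$ is directed with supremum $x$. A map $f:P\to Q$ is Scott continuous if, for every directed $D$ with a supremum, $f(\sqcup D)$ is the supremum of $f^{\to}(D)$. An $L$-subset $A$ is Scott open if $A(x)\wedge e(x,y)\le A(y)$ for all $x,y$ and $A(\sqcup D)=\bigvee_x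 A(x)\wedge D(x)$ for every directed $D$ with a supremum. Let $L\text{-}\mathbf{LSCSob}$ be the category of locally super-compact $L$-sober spaces and continuous maps, and $L\text{-}\mathbf{CDom}$ the category of continuous $L$-dcpo's and Scott continuous maps. Let $\Sigma_L$ send a continuous $L$-dcpo $P$ to the set $P$ with the $L$-topology of its Scott open sets, and let $\Omega_L$ send a space $X$ to the set $X$ with the specialization $L$-order $e(x,y)=\bigwedge_{A\in\mathcal O(X)}(A(x)\to A(y))$; both leave the underlying maps of morphisms unchanged. **Theorem.** $\Sigma_L$ and $\Omega_L$ are well-defined functors $L\text{-}\mathbf{CDom}\to L\text{-}\mathbf{LSCSob}$ and $L\text{-}\mathbf{LSCSob}\to L\text{-}\mathbf{CDom}$, and $\Sigma_L\circ\Omega_L=\mathrm{id}$ and $\Omega_L\circ\Sigma_L=\mathrm{id}$. Hence the categories $L\text{-}\mathbf{LSCSob}$ and $L\text{-}\mathbf{CDom}$ are isomorphic. -/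

import Mathlib

universe u v

open CategoryTheory

namespace LDom

/-! ### `L`-subsets -/

/-- The inclusion degree `sub(A, B) = ⋀ₓ A(x) → B(x)` of two `L`-subsets. -/
def sub {L : Type v} [Order.Frame L] {X : Type u} (A B : X → L) : L :=
  ⨅ x, A x ⇨ B x

/-- An `L`-subset is nonempty if the join of its values is `1`. -/
def IsNonempty {L : Type v} [Order.Frame L] {X : Type u} (A : X → L) : Prop :=
  ⨆ x, A x = ⊤

/-- The forward Zadeh extension `f^→(A)(y) = ⋁_{f(x) = y} A(x)`. -/
def zadeh {L : Type v} [Order.Frame L] {X Y : Type u} (f : X → Y) (A : X → L) : Y → L :=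
  fun y => ⨆ (x : X) (_ : f x = y), A x

/-! ### `L`-topological spaces -/

/-- A (stratified) `L`-topology on `X`. -/
@[ext]
structure LTopology (L : Type v) [Order.Frame L] (X : Type u) where
  opens : Set (X → L)
  inf_mem : ∀ A ∈ opens, ∀ B ∈ opens, A ⊓ B ∈ opens
  sSup_mem : ∀ S : Set (X → L), S ⊆ opens → sSup S ∈ opens
  const_mem : ∀ a : L, (fun _ => a) ∈ opens

namespace LTopology

/-- The interior of an `L`-subset: the join of the open sets below it. -/
def interior {L : Type v} [Order.Frame L] {X : Type u} (T : LTopology L X)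
    (A : X → L) : X → L :=
  sSup {B | B ∈ T.opens ∧ B ≤ A}

def IsT0 {L : Type v} [Order.Frame L] {X : Type u} (T : LTopology L X) : Prop :=
  ∀ x y : X, (∀ A ∈ T.opens, A x = A y) → x = y

/-- Super-compact `L`-subsets. -/
def IsSuperCompact {L : Type v} [Order.Frame L] {X : Type u} (T : LTopology L X)
    (A : X → L) : Prop :=
  IsNonempty A ∧ ∀ S : Set (X → L), S ⊆ T.opens → sub A (sSup S) = ⨆ V ∈ S, sub A V

/-- `A = ⋁_{B super-compact} sub(B, A) ∧ B°` for every open `A`. -/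
def IsLocallySuperCompact {L : Type v} [Order.Frame L] {X : Type u}
    (T : LTopology L X) : Prop :=
  ∀ A ∈ T.opens, ∀ x : X,
    A x = ⨆ (B : X → L) (_ : T.IsSuperCompact B), sub B A ⊓ T.interior B x

/-- The points of `𝒪(X)`: maps `p : 𝒪(X) → L` preserving binary meets, arbitrary joins and
constants. -/
structure Point {L : Type v} [Order.Frame L] {X : Type u} (T : LTopology L X) where
  toFun : T.opens → L
  map_inf : ∀ A B : T.opens,
    toFun ⟨A.1 ⊓ B.1, T.inf_mem A.1 A.2 B.1 B.2⟩ = toFun A ⊓ toFun B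
  map_sSup : ∀ (S : Set (X → L)) (hS : S ⊆ T.opens),
    toFun ⟨sSup S, T.sSup_mem S hS⟩ = ⨆ V : S, toFun ⟨V.1, hS V.2⟩
  map_const : ∀ a : L, toFun ⟨fun _ => a, T.const_mem a⟩ = a

/-- The point `[x]` with `[x](A) = A(x)`. -/
def pointOf {L : Type v} [Order.Frame L] {X : Type u} (T : LTopology L X) (x : X) :
    T.Point where
  toFun A := A.1 x
  map_inf _ _ := rfl
  map_sSup S _ := by
    show sSup S x = _
    rw [sSup_apply]
  map_const _ := rfl

/-- `L`-sobriety: `x ↦ [x]` is a bijection from `X` onto the set of points of `𝒪(X)`. -/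
def IsSober {L : Type v} [Order.Frame L] {X : Type u} (T : LTopology L X) : Prop :=
  Function.Bijective T.pointOf

theorem IsSober.isT0 {L : Type v} [Order.Frame L] {X : Type u} {T : LTopology L X}
    (h : T.IsSober) : T.IsT0 := by
  intro x y hxy
  apply h.1
  simp only [pointOf, Point.mk.injEq]
  funext A
  exact hxy A.1 A.2

end LTopology

/-- Continuity of a map between `L`-topological spaces: `B ∘ f` is open for every open `B`. -/
def IsContinuousMap {L : Type v} [Order.Frame L] {X Y : Type u}
    (S : LTopology L X) (T : LTopology L Y) (f : X → Y) : Prop :=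
  ∀ B ∈ T.opens, B ∘ f ∈ S.opens

/-! ### `L`-ordered sets -/

/-- An `L`-order on `P`. -/
@[ext]
structure LOrder (L : Type v) [Order.Frame L] (P : Type u) where
  e : P → P → L
  refl : ∀ x, e x x = ⊤
  trans : ∀ x y z, e x y ⊓ e y z ≤ e x z
  antisymm : ∀ x y, e x y ⊓ e y x = ⊤ → x = y

namespace LOrder

/-- `s` is a supremum of the `L`-subset `A`: `e(s, y) = sub(A, ↓y)` for all `y`. -/
def IsSup {L : Type v} [Order.Frame L] {P : Type u} (E : LOrder L P)
    (A : P → L) (s : P) : Prop :=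
  ∀ y, E.e s y = sub A (fun z => E.e z y)

/-- Directed `L`-subsets. -/
def IsDirected {L : Type v} [Order.Frame L] {P : Type u} (E : LOrder L P)
    (D : P → L) : Prop :=
  IsNonempty D ∧ ∀ x y, D x ⊓ D y ≤ ⨆ z, D z ⊓ E.e x z ⊓ E.e y z

/-- Upper `L`-subsets. -/
def IsUpper {L : Type v} [Order.Frame L] {P : Type u} (E : LOrder L P)
    (A : P → L) : Prop :=
  ∀ x y, A x ⊓ E.e x y ≤ A y

/-- `L`-dcpo's: every directed `L`-subset has a supremum. -/
def IsDcpo {L : Type v} [Order.Frame L] {P : Type u} (E : LOrder L P) : Prop :=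
  ∀ D : P → L, E.IsDirected D → ∃ s, E.IsSup D s

/-- `E.wayBelow x y` is the degree to which `y` is way below `x`: the meet of
`e(x, ⊔D) → ⋁_d D(d) ∧ e(y, d)` over all directed `D` that have a supremum. -/
def wayBelow {L : Type v} [Order.Frame L] {P : Type u} (E : LOrder L P) (x : P) : P → L :=
  fun y => ⨅ (D : P → L) (s : P) (_ : E.IsDirected D) (_ : E.IsSup D s),
    E.e x s ⇨ ⨆ d, D d ⊓ E.e y d

/-- Continuous `L`-ordered sets. -/
def IsContinuous {L : Type v} [Order.Frame L] {P : Type u} (E : LOrder L P) : Prop :=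
  ∀ x, E.IsDirected (E.wayBelow x) ∧ E.IsSup (E.wayBelow x) x

/-- Scott open `L`-subsets. -/
def IsScottOpen {L : Type v} [Order.Frame L] {P : Type u} (E : LOrder L P)
    (A : P → L) : Prop :=
  E.IsUpper A ∧ ∀ (D : P → L) (s : P), E.IsDirected D → E.IsSup D s →
    A s = ⨆ x, A x ⊓ D x

/-- A supremum of `D` is an upper bound of `D`. -/
theorem IsSup.le {L : Type v} [Order.Frame L] {P : Type u} {E : LOrder L P}
    {A : P → L} {s : P} (h : E.IsSup A s) (x : P) : A x ≤ E.e x s := by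
  have h1 := h s
  rw [E.refl] at h1
  have h2 : sub A (fun z => E.e z s) ≤ A x ⇨ E.e x s := iInf_le _ x
  rw [← h1, top_le_iff, himp_eq_top_iff] at h2
  exact h2

/-- The Scott `L`-topology `σ_L(P)`. -/
def scott {L : Type v} [Order.Frame L] {P : Type u} (E : LOrder L P) : LTopology L P where
  opens := {A | E.IsScottOpen A}
  inf_mem := by
    rintro A ⟨hA, hA'⟩ B ⟨hB, hB'⟩
    refine ⟨fun x y => ?_, fun D s hD hs => ?_⟩
    · exact le_inf (le_trans (inf_le_inf_right _ inf_le_left) (hA x y))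
        (le_trans (inf_le_inf_right _ inf_le_right) (hB x y))
    · apply le_antisymm
      · show A s ⊓ B s ≤ _
        rw [hA' D s hD hs, hB' D s hD hs, iSup_inf_iSup]
        refine iSup_le fun p => ?_
        calc A p.1 ⊓ D p.1 ⊓ (B p.2 ⊓ D p.2)
            = A p.1 ⊓ B p.2 ⊓ (D p.1 ⊓ D p.2) := inf_inf_inf_comm _ _ _ _
          _ ≤ A p.1 ⊓ B p.2 ⊓ ⨆ z, D z ⊓ E.e p.1 z ⊓ E.e p.2 z :=
              inf_le_inf_left _ (hD.2 _ _)
          _ ≤ _ := by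
              rw [inf_iSup_eq]
              refine iSup_mono fun z => le_inf (le_inf ?_ ?_) ?_
              · refine le_trans (le_inf ?_ ?_) (hA p.1 z)
                · exact inf_le_left.trans inf_le_left
                · exact inf_le_right.trans (inf_le_left.trans inf_le_right)
              · refine le_trans (le_inf ?_ ?_) (hB p.2 z)
                · exact inf_le_left.trans inf_le_right
                · exact inf_le_right.trans inf_le_right
              · exact inf_le_right.trans (inf_le_left.trans inf_le_left)
      · refine iSup_le fun x => le_inf ?_ ?_
        · exact le_trans (le_inf (inf_le_left.trans inf_le_left)
            (inf_le_right.trans (hs.le x))) (hA x s)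
        · exact le_trans (le_inf (inf_le_left.trans inf_le_right)
            (inf_le_right.trans (hs.le x))) (hB x s)
  sSup_mem := by
    intro S hS
    refine ⟨fun x y => ?_, fun D s hD hs => ?_⟩
    · rw [sSup_apply, sSup_apply, iSup_inf_eq]
      exact iSup_mono fun A => (hS A.2).1 x y
    · simp only [sSup_apply, iSup_inf_eq]
      rw [iSup_comm]
      exact iSup_congr fun A => (hS A.2).2 D s hD hs
  const_mem := by
    intro a
    refine ⟨fun x y => inf_le_left, fun D s hD _ => ?_⟩
    show a = ⨆ x, a ⊓ D x
    rw [← inf_iSup_eq, hD.1, inf_top_eq]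

end LOrder

/-- The specialization `L`-order `e(x, y) = ⋀_{A open} A(x) → A(y)` of a `T₀` space. -/
def LTopology.specOrder {L : Type v} [Order.Frame L] {X : Type u} (T : LTopology L X)
    (h : T.IsT0) : LOrder L X where
  e x y := ⨅ A ∈ T.opens, A x ⇨ A y
  refl x := by simp
  trans x y z := by
    refine le_iInf₂ fun A hA => ?_
    refine le_trans (inf_le_inf (iInf₂_le A hA) (iInf₂_le A hA)) ?_
    rw [le_himp_iff, inf_comm, ← inf_assoc]
    exact (inf_le_inf_right _ inf_himp_le).trans inf_himp_le
  antisymm x y hxy := by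
    rw [inf_eq_top_iff] at hxy
    simp only [iInf_eq_top, himp_eq_top_iff] at hxy
    exact h x y fun A hA => le_antisymm (hxy.1 A hA) (hxy.2 A hA)

/-! ### Scott continuous maps -/

/-- Scott continuity: for every directed `D` with a supremum `s`, the `L`-subset `f^→(D)` has
the supremum `f(s)`. -/
def IsScottContinuous {L : Type v} [Order.Frame L] {P Q : Type u}
    (E : LOrder L P) (F : LOrder L Q) (f : P → Q) : Prop :=
  ∀ (D : P → L) (s : P), E.IsDirected D → E.IsSup D s → F.IsSup (zadeh f D) (f s)

theorem isScottContinuous_id {L : Type v} [Order.Frame L] {P : Type u} (E : LOrder L P) :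
    IsScottContinuous E E id := by
  intro D s _ hs
  have : zadeh id D = D := by
    funext y
    simp [zadeh]
  rw [this]
  exact hs

theorem IsScottContinuous.mono {L : Type v} [Order.Frame L] {P Q : Type u}
    {E : LOrder L P} {F : LOrder L Q} {f : P → Q} (hf : IsScottContinuous E F f) (x y : P) :
    E.e x y ≤ F.e (f x) (f y) := by
  have hdir : E.IsDirected (fun z => E.e z y) := by
    refine ⟨top_le_iff.1 ?_, fun a b => ?_⟩
    · rw [← E.refl y]
      exact le_iSup (fun z => E.e z y) y
    · refine le_trans ?_ (le_iSup _ y)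
      simp [E.refl]
  have hsup : E.IsSup (fun z => E.e z y) y := by
    intro w
    apply le_antisymm
    · refine le_iInf fun z => ?_
      rw [le_himp_iff, inf_comm]
      exact E.trans z y w
    · refine (iInf_le _ y).trans ?_
      simp [E.refl]
  refine le_trans ?_ ((hf _ _ hdir hsup).le (f x))
  exact le_iSup₂_of_le x rfl le_rfl

theorem IsScottContinuous.comp {L : Type v} [Order.Frame L] {P Q R : Type u}
    {E : LOrder L P} {F : LOrder L Q} {G : LOrder L R} {g : Q → R} {f : P → Q}
    (hg : IsScottContinuous F G g) (hf : IsScottContinuous E F f) :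
    IsScottContinuous E G (g ∘ f) := by
  intro D s hD hs
  have hz : zadeh (g ∘ f) D = zadeh g (zadeh f D) := by
    funext r
    apply le_antisymm
    · refine iSup₂_le fun x hx => ?_
      exact le_iSup₂_of_le (f x) hx (le_iSup₂_of_le x rfl le_rfl)
    · refine iSup₂_le fun q hq => iSup₂_le fun x hx => ?_
      exact le_iSup₂_of_le x (by rw [Function.comp_apply, hx, hq]) le_rfl
  have hdir : F.IsDirected (zadeh f D) := by
    refine ⟨top_le_iff.1 ?_, fun a b => ?_⟩
    · rw [← hD.1]
      refine iSup_le fun x => ?_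
      exact le_iSup_of_le (f x) (le_iSup₂_of_le x rfl le_rfl)
    · simp only [zadeh, iSup_inf_eq, inf_iSup_eq]
      refine iSup₂_le fun x hx => iSup₂_le fun y hy => ?_
      subst hx hy
      refine (hD.2 _ _).trans (iSup_le fun z => ?_)
      refine le_iSup_of_le (f z) (le_iSup₂_of_le z rfl ?_)
      exact inf_le_inf (inf_le_inf_left _ (hf.mono _ _)) (hf.mono _ _)
  rw [hz]
  exact hg _ _ hdir (hf D s hD hs)

/-! ### The two categories -/

/-- Locally super-compact `L`-sober spaces. -/
structure LSCSob (L : Type v) [Order.Frame L] where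
  carrier : Type u
  top : LTopology L carrier
  isLocallySuperCompact : top.IsLocallySuperCompact
  isSober : top.IsSober

/-- Continuous maps between locally super-compact `L`-sober spaces. -/
@[ext]
structure LSCSob.Hom {L : Type v} [Order.Frame L] (X Y : LSCSob.{u, v} L) where
  toFun : X.carrier → Y.carrier
  isContinuousMap : IsContinuousMap X.top Y.top toFun

/-- The category `L`-LSCSob. -/
instance LSCSob.category (L : Type v) [Order.Frame L] : Category (LSCSob.{u, v} L) where
  Hom := LSCSob.Hom
  id X := ⟨id, fun _ hB => hB⟩
  comp f g := ⟨g.toFun ∘ f.toFun, fun B hB =>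
    f.isContinuousMap (B ∘ g.toFun) (g.isContinuousMap B hB)⟩

/-- Continuous `L`-dcpo's. -/
structure CDom (L : Type v) [Order.Frame L] where
  carrier : Type u
  ord : LOrder L carrier
  isDcpo : ord.IsDcpo
  isContinuous : ord.IsContinuous

/-- Scott continuous maps between continuous `L`-dcpo's. -/
@[ext]
structure CDom.Hom {L : Type v} [Order.Frame L] (P Q : CDom.{u, v} L) where
  toFun : P.carrier → Q.carrier
  isScottContinuous : IsScottContinuous P.ord Q.ord toFun

/-- The category `L`-CDom. -/
instance CDom.category (L : Type v) [Order.Frame L] : Category (CDom.{u, v} L) where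
  Hom := CDom.Hom
  id P := ⟨id, isScottContinuous_id P.ord⟩
  comp f g := ⟨g.toFun ∘ f.toFun, g.isScottContinuous.comp f.isScottContinuous⟩

/-! ### The two assignments

Each is a functor as soon as it is well defined on objects and on morphisms; these two facts
are passed as arguments and are part of what has to be shown. -/

/-- `Σ_L`: it equips a continuous `L`-dcpo with its Scott `L`-topology and does not change the
underlying maps. -/
def scottFunctor {L : Type v} [Order.Frame L]
    (hobj : ∀ P : CDom.{u, v} L,
      P.ord.scott.IsLocallySuperCompact ∧ P.ord.scott.IsSober)
    (hmap : ∀ (P Q : CDom.{u, v} L) (f : P ⟶ Q),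
      IsContinuousMap P.ord.scott Q.ord.scott f.toFun) :
    CDom.{u, v} L ⥤ LSCSob.{u, v} L where
  obj P := ⟨P.carrier, P.ord.scott, (hobj P).1, (hobj P).2⟩
  map {P Q} f := ⟨f.toFun, hmap P Q f⟩

/-- The specialization `L`-order of a locally super-compact `L`-sober space. -/
def LSCSob.spec {L : Type v} [Order.Frame L] (X : LSCSob.{u, v} L) : LOrder L X.carrier :=
  X.top.specOrder X.isSober.isT0

/-- `Ω_L`: it equips a locally super-compact `L`-sober space with its specialization `L`-order
and does not change the underlying maps. -/
def specFunctor {L : Type v} [Order.Frame L]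
    (hobj : ∀ X : LSCSob.{u, v} L, X.spec.IsDcpo ∧ X.spec.IsContinuous)
    (hmap : ∀ (X Y : LSCSob.{u, v} L) (f : X ⟶ Y),
      IsScottContinuous X.spec Y.spec f.toFun) :
    LSCSob.{u, v} L ⥤ CDom.{u, v} L where
  obj X := ⟨X.carrier, X.spec, (hobj X).1, (hobj X).2⟩
  map {X Y} f := ⟨f.toFun, hmap X Y f⟩

end LDom

namespace LDom

open LTopology

/-! ### Degrees of inclusion -/

/-! Both passages rest on one expansion, A x = ⋁_y A y ∧ U_y x for open A, where U_y is an open set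
below the principal filter `e y`. On the order side U_y is the set of points that y is way below: it
is Scott open by interpolation (`IsContinuous.wayBelow_le_iSup`), and the expansion is Scott
openness of A applied to x as the supremum of its way-below set. A point p preserves the expansion,
so p is determined by the directed `L`-subset y ↦ p(U_y) and is evaluation at its supremum. This
gives sobriety.

On the space side U_y is the interior of `e y`. Sobriety is used twice: a directed D yields the
point A ↦ ⋁ A x ∧ D x, hence a supremum at which every open set is Scott open; a super-compact B
yields the point A ↦ sub(B, A), so on open sets B acts like some principal filter, and local
super-compactness becomes the expansion. Then U_y is also the way-below set, whence continuity of
the order and the equality of the two topologies. -/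

theorem sub_inf_le {L : Type v} [Order.Frame L] {X : Type u} (A B : X → L) (x : X) :
    sub A B ⊓ A x ≤ B x :=
  (inf_le_inf_right _ (iInf_le _ x)).trans himp_inf_le

theorem le_sub_iff {L : Type v} [Order.Frame L] {X : Type u} {A B : X → L} {a : L} :
    a ≤ sub A B ↔ ∀ x, a ⊓ A x ≤ B x := by
  simp [sub, le_iInf_iff, le_himp_iff]

namespace LOrder

/-! ### `L`-ordered sets -/

section

variable {L : Type v} [Order.Frame L] {P : Type u} {E : LOrder L P}

theorem isDirected_principal (E : LOrder L P) (y : P) : E.IsDirected (fun z => E.e z y) := by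
  refine ⟨top_le_iff.1 ?_, fun a b => ?_⟩
  · rw [← E.refl y]
    exact le_iSup (fun z => E.e z y) y
  · refine le_trans ?_ (le_iSup _ y)
    simp [E.refl]

theorem isSup_principal (E : LOrder L P) (y : P) : E.IsSup (fun z => E.e z y) y := by
  intro w
  apply le_antisymm
  · refine le_iInf fun z => ?_
    rw [le_himp_iff, inf_comm]
    exact E.trans z y w
  · refine (iInf_le _ y).trans ?_
    simp [E.refl]

theorem IsSup.unique {A : P → L} {s t : P} (hs : E.IsSup A s) (ht : E.IsSup A t) : s = t := by
  apply E.antisymm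
  rw [hs t, ← ht t, ht s, ← hs s, E.refl, E.refl, inf_top_eq]

theorem IsUpper.sub_principal {A : P → L} (hA : E.IsUpper A) (y : P) :
    sub (E.e y) A = A y := by
  apply le_antisymm
  · simpa [E.refl] using sub_inf_le (E.e y) A y
  · exact le_sub_iff.2 fun x => hA y x

/-- By the Yoneda identity `IsUpper.sub_principal`, inclusion of `e y` in an open set is evaluation
at y, and joins are pointwise. -/
theorem isSuperCompact_principal (E : LOrder L P) {T : LTopology L P}
    (hT : ∀ A ∈ T.opens, E.IsUpper A) (y : P) : T.IsSuperCompact (E.e y) := by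
  refine ⟨top_le_iff.1 ((E.refl y).ge.trans (le_iSup (E.e y) y)), fun S hS => ?_⟩
  rw [(hT _ (T.sSup_mem S hS)).sub_principal, sSup_apply, iSup_subtype]
  exact iSup_congr fun V => iSup_congr fun hV => ((hT V (hS hV)).sub_principal y).symm

/-- Directedness replaces two witnesses by a common upper bound, which stays in the upper sets. This
makes A ↦ ⋁ A x ∧ D x preserve binary meets. -/
theorem IsDirected.iSup_inf_inf {D : P → L} (hD : E.IsDirected D) {A B : P → L}
    (hA : E.IsUpper A) (hB : E.IsUpper B) :
    ⨆ x, A x ⊓ B x ⊓ D x = (⨆ x, A x ⊓ D x) ⊓ ⨆ x, B x ⊓ D x := by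
  apply le_antisymm
  · exact le_inf (iSup_mono fun x => inf_le_inf_right (D x) inf_le_left)
      (iSup_mono fun x => inf_le_inf_right (D x) inf_le_right)
  · rw [iSup_inf_iSup]
    refine iSup_le fun p => ?_
    rw [inf_inf_inf_comm]
    refine (inf_le_inf_left _ (hD.2 _ _)).trans ?_
    rw [inf_iSup_eq]
    refine iSup_mono fun z => le_inf ((inf_le_inf (hA p.1 z) (hB p.2 z)).trans' ?_) ?_
    · rw [inf_inf_inf_comm (A p.1) (E.e p.1 z)]
      exact inf_le_inf_left _ (le_inf (inf_le_left.trans inf_le_right) inf_le_right)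
    · exact inf_le_right.trans (inf_le_left.trans inf_le_left)

/-! ### The way below relation -/

theorem wayBelow_inf_le (E : LOrder L P) {D : P → L} {s : P} (hD : E.IsDirected D)
    (hs : E.IsSup D s) (x y : P) : E.wayBelow x y ⊓ E.e x s ≤ ⨆ d, D d ⊓ E.e y d := by
  rw [← le_himp_iff]
  exact iInf_le_of_le D (iInf_le_of_le s (iInf_le_of_le hD (iInf_le _ hs)))

theorem wayBelow_le_of_isSup (E : LOrder L P) {D : P → L} {s : P} (hD : E.IsDirected D)
    (hs : E.IsSup D s) (y : P) : E.wayBelow s y ≤ ⨆ d, D d ⊓ E.e y d := by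
  simpa [E.refl] using E.wayBelow_inf_le hD hs s y

theorem wayBelow_le (E : LOrder L P) (x y : P) : E.wayBelow x y ≤ E.e y x := by
  refine (E.wayBelow_le_of_isSup (E.isDirected_principal x) (E.isSup_principal x) y).trans
    (iSup_le fun d => ?_)
  rw [inf_comm]
  exact E.trans y d x

theorem isUpper_wayBelow (E : LOrder L P) (y : P) : E.IsUpper (fun x => E.wayBelow x y) := by
  intro x x'
  refine le_iInf fun D => le_iInf fun s => le_iInf fun hD => le_iInf fun hs => ?_
  rw [le_himp_iff, inf_assoc]
  exact (inf_le_inf_left _ (E.trans x x' s)).trans (E.wayBelow_inf_le hD hs x y)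

theorem inf_wayBelow_le (E : LOrder L P) (x y z : P) :
    E.e y z ⊓ E.wayBelow x z ≤ E.wayBelow x y := by
  refine le_iInf fun D => le_iInf fun s => le_iInf fun hD => le_iInf fun hs => ?_
  rw [le_himp_iff, inf_assoc]
  refine (inf_le_inf_left _ (E.wayBelow_inf_le hD hs x z)).trans ?_
  rw [inf_iSup_eq]
  refine iSup_mono fun d => ?_
  rw [inf_left_comm]
  exact inf_le_inf_left _ (E.trans y z d)

/-- Interpolation. The union D of the sets ⇓z, weighted by z ≪ x, is again directed with supremum x;
testing y ≪ x against D gives the bound, since D is a lower set. -/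
theorem IsContinuous.wayBelow_le_iSup (hE : E.IsContinuous) (x y : P) :
    E.wayBelow x y ≤ ⨆ z, E.wayBelow x z ⊓ E.wayBelow z y := by
  set D : P → L := fun y => ⨆ z, E.wayBelow x z ⊓ E.wayBelow z y with hDdef
  have hD : E.IsDirected D := by
    constructor
    · show ⨆ y, ⨆ z, E.wayBelow x z ⊓ E.wayBelow z y = ⊤
      rw [iSup_comm, ← (hE x).1.1]
      refine iSup_congr fun z => ?_
      rw [← inf_iSup_eq, (hE z).1.1, inf_top_eq]
    · intro a b
      simp only [hDdef, iSup_inf_eq, inf_iSup_eq]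
      refine iSup_le fun z' => iSup_le fun z => ?_
      calc E.wayBelow x z ⊓ E.wayBelow z a ⊓ (E.wayBelow x z' ⊓ E.wayBelow z' b)
          = E.wayBelow x z ⊓ E.wayBelow x z' ⊓ (E.wayBelow z a ⊓ E.wayBelow z' b) :=
            inf_inf_inf_comm _ _ _ _
        _ ≤ (⨆ t, E.wayBelow x t ⊓ E.e z t ⊓ E.e z' t) ⊓
              (E.wayBelow z a ⊓ E.wayBelow z' b) := inf_le_inf_right _ ((hE x).1.2 z z')
        _ ≤ ⨆ t, E.wayBelow x t ⊓ (E.wayBelow t a ⊓ E.wayBelow t b) := by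
            rw [iSup_inf_eq]
            refine iSup_mono fun t => ?_
            have h1 := E.isUpper_wayBelow a z t
            have h2 := E.isUpper_wayBelow b z' t
            calc _ = E.wayBelow x t ⊓ ((E.wayBelow z a ⊓ E.e z t) ⊓
                      (E.wayBelow z' b ⊓ E.e z' t)) := by
                    simp only [inf_assoc, inf_comm, inf_left_comm]
              _ ≤ _ := inf_le_inf_left _ (inf_le_inf h1 h2)
        _ ≤ ⨆ t, ⨆ c, E.wayBelow x t ⊓ E.wayBelow t c ⊓ E.e a c ⊓ E.e b c := by
            refine iSup_mono fun t => (inf_le_inf_left _ ((hE t).1.2 a b)).trans ?_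
            rw [inf_iSup_eq]
            exact iSup_mono fun c => by simp only [inf_assoc, le_refl]
        _ = _ := iSup_comm.trans (by rfl)
  -- An upper bound of D bounds each ⇓z, hence each z ≪ x, hence x; these are equivalences in
  -- degree.
  have hs : E.IsSup D x := by
    intro y
    refine eq_of_forall_le_iff fun a => ?_
    rw [(hE x).2 y, le_sub_iff, le_sub_iff]
    simp only [hDdef, inf_iSup_eq, iSup_le_iff]
    rw [forall_comm]
    refine forall_congr' fun z => ?_
    rw [(hE z).2 y, le_sub_iff]
    simp only [inf_assoc]
  refine (E.wayBelow_le_of_isSup hD hs y).trans (iSup_le fun d => ?_)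
  simp only [hDdef, iSup_inf_eq]
  refine iSup_mono fun z => ?_
  rw [inf_assoc, inf_comm (E.wayBelow z d)]
  exact inf_le_inf_left _ (E.inf_wayBelow_le z y d)

theorem IsContinuous.isScottOpen_wayBelow (hE : E.IsContinuous) (y : P) :
    E.IsScottOpen (fun x => E.wayBelow x y) := by
  refine ⟨E.isUpper_wayBelow y, fun D s hD hs => le_antisymm ?_ ?_⟩
  · refine (hE.wayBelow_le_iSup s y).trans (iSup_le fun z => ?_)
    refine (inf_le_inf_right _ (E.wayBelow_le_of_isSup hD hs z)).trans ?_
    rw [iSup_inf_eq]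
    refine iSup_mono fun d => ?_
    rw [inf_assoc, inf_comm (D d), inf_comm (E.e z d)]
    exact inf_le_inf_right _ (E.isUpper_wayBelow y z d)
  · exact iSup_le fun x => (inf_le_inf_left _ (hs.le x)).trans (E.isUpper_wayBelow y x s)

/-- The basis expansion on the order side. -/
theorem IsContinuous.apply_eq_iSup (hE : E.IsContinuous) {A : P → L} (hA : E.IsScottOpen A)
    (x : P) : A x = ⨆ y, A y ⊓ E.wayBelow x y :=
  hA.2 _ _ (hE x).1 (hE x).2

/-! ### The Scott topology of a continuous `L`-ordered set -/

theorem IsContinuous.isLocallySuperCompact (hE : E.IsContinuous) :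
    E.scott.IsLocallySuperCompact := by
  intro A hA x
  apply le_antisymm
  · rw [hE.apply_eq_iSup hA x]
    refine iSup_le fun y => ?_
    refine le_iSup₂_of_le (E.e y) (E.isSuperCompact_principal (T := E.scott) (fun A hA => And.left hA) y) ?_
    rw [hA.1.sub_principal]
    refine inf_le_inf_left _ ?_
    exact (le_sSup (a := fun x => E.wayBelow x y)
      ⟨hE.isScottOpen_wayBelow y, fun z => E.wayBelow_le z y⟩ :
        (fun x => E.wayBelow x y) ≤ E.scott.interior (E.e y)) x
  · refine iSup₂_le fun B _ => ?_
    have hB : E.scott.interior B ≤ B := sSup_le fun C hC => hC.2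
    exact (inf_le_inf_left _ (hB x)).trans (sub_inf_le B A x)

end

end LOrder

/-! ### Interiors, and points as `L`-linear maps -/

namespace LTopology

section

variable {L : Type v} [Order.Frame L] {X : Type u} {T : LTopology L X}

theorem interior_le (T : LTopology L X) (A : X → L) : T.interior A ≤ A :=
  sSup_le fun _ hC => hC.2

theorem interior_mem (T : LTopology L X) (A : X → L) : T.interior A ∈ T.opens :=
  T.sSup_mem _ fun _ hB => hB.1

theorem le_interior {A B : X → L} (hB : B ∈ T.opens) (h : B ≤ A) : B ≤ T.interior A :=
  le_sSup ⟨hB, h⟩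

theorem const_inf_mem {A : X → L} (hA : A ∈ T.opens) (a : L) : (fun x => a ⊓ A x) ∈ T.opens :=
  T.inf_mem _ (T.const_mem a) _ hA

theorem iSup_mem (T : LTopology L X) {ι : Sort*} {A : ι → X → L} (hA : ∀ i, A i ∈ T.opens) :
    (fun x => ⨆ i, A i x) ∈ T.opens := by
  have h := T.sSup_mem (Set.range A) (by rintro _ ⟨i, rfl⟩; exact hA i)
  rwa [show sSup (Set.range A) = fun x => ⨆ i, A i x from funext fun x => by
    rw [sSup_range, iSup_apply]] at h

theorem Point.congr (p : T.Point) {A B : T.opens} (h : A.1 = B.1) : p.toFun A = p.toFun B := by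
  rw [Subtype.ext h]

theorem Point.map_iSup_inf (p : T.Point) {ι : Sort*} (a : ι → L) {A : ι → X → L}
    (hA : ∀ i, A i ∈ T.opens) {B : X → L} (hB : B ∈ T.opens)
    (h : ∀ x, B x = ⨆ i, a i ⊓ A i x) :
    p.toFun ⟨B, hB⟩ = ⨆ i, a i ⊓ p.toFun ⟨A i, hA i⟩ := by
  have hS : Set.range (fun i x => a i ⊓ A i x) ⊆ T.opens := by
    rintro _ ⟨i, rfl⟩
    exact const_inf_mem (hA i) (a i)
  have hB' : B = sSup (Set.range (fun i x => a i ⊓ A i x)) := by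
    funext x
    rw [h, sSup_range, iSup_apply]
  rw [p.congr (B := ⟨_, T.sSup_mem _ hS⟩) hB', p.map_sSup _ hS]
  have key : ∀ i, p.toFun ⟨fun x => a i ⊓ A i x, const_inf_mem (hA i) (a i)⟩ =
      a i ⊓ p.toFun ⟨A i, hA i⟩ := fun i => by
    have := p.map_inf ⟨fun _ => a i, T.const_mem (a i)⟩ ⟨A i, hA i⟩
    rw [p.map_const] at this
    exact this
  apply le_antisymm
  · refine iSup_le ?_
    rintro ⟨_, i, rfl⟩
    exact (key i).le.trans (le_iSup (fun i => a i ⊓ p.toFun ⟨A i, hA i⟩) i)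
  · refine iSup_le fun i => (key i).ge.trans ?_
    exact le_iSup (fun V : Set.range (fun i x => a i ⊓ A i x) => p.toFun ⟨V.1, hS V.2⟩)
      ⟨_, i, rfl⟩

end

end LTopology

/-! ### Sobriety and specialization order of the Scott topology -/

namespace LOrder

section

variable {L : Type v} [Order.Frame L] {P : Type u} {E : LOrder L P}

theorem IsContinuous.isSober (hE : E.IsContinuous) (hd : E.IsDcpo) : E.scott.IsSober := by
  constructor
  · intro x y hxy
    -- Equal points agree on the basic open sets, so x and y are suprema of the same `L`-subset.
    have h : E.wayBelow x = E.wayBelow y := funext fun z =>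
      congrArg (fun p : E.scott.Point => p.toFun ⟨_, hE.isScottOpen_wayBelow z⟩) hxy
    exact (hE x).2.unique (h ▸ (hE y).2)
  · intro p
    have key : ∀ (A : P → L) (hA : A ∈ E.scott.opens), p.toFun ⟨A, hA⟩ =
        ⨆ y, A y ⊓ p.toFun ⟨fun x => E.wayBelow x y, hE.isScottOpen_wayBelow y⟩ :=
      fun A hA => p.map_iSup_inf A (A := fun y x => E.wayBelow x y) hE.isScottOpen_wayBelow hA
        (hE.apply_eq_iSup hA)
    have hdir : E.IsDirected (fun y => p.toFun ⟨_, hE.isScottOpen_wayBelow y⟩) := by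
      constructor
      · have := key _ (E.scott.const_mem ⊤)
        rw [p.map_const] at this
        simpa [IsNonempty] using this.symm
      · intro a b
        -- Expanding p on the meet of the two basic open sets produces the upper bounds of a and b.
        rw [← p.map_inf ⟨_, hE.isScottOpen_wayBelow a⟩ ⟨_, hE.isScottOpen_wayBelow b⟩, key]
        refine iSup_mono fun y => ?_
        rw [inf_comm, inf_assoc]
        exact inf_le_inf_left _ (inf_le_inf (E.wayBelow_le y a) (E.wayBelow_le y b))
    obtain ⟨s, hs⟩ := hd _ hdir
    refine ⟨s, ?_⟩
    obtain ⟨f, _, _, _⟩ := p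
    simp only [pointOf, Point.mk.injEq]
    funext A
    rw [show f A = _ from key A.1 A.2]
    exact A.2.2 _ s hdir hs

/-- Scott open sets are upper, so they cannot separate more than `e`; the basic ones already recover
`e`, because x is the supremum of ⇓x. -/
theorem IsContinuous.specOrder_scott (hE : E.IsContinuous) (h : E.scott.IsT0) :
    E.scott.specOrder h = E := by
  ext x y
  apply le_antisymm
  · rw [(hE x).2 y]
    refine le_iInf fun z => ?_
    refine (iInf₂_le (fun x => E.wayBelow x z) (hE.isScottOpen_wayBelow z)).trans ?_
    exact himp_le_himp_left (E.wayBelow_le y z)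
  · refine le_iInf₂ fun A hA => ?_
    rw [le_himp_iff, inf_comm]
    exact hA.1 x y

end

end LOrder

/-! ### Scott continuous maps -/

theorem iSup_inf_zadeh {L : Type v} [Order.Frame L] {X Y : Type u} (f : X → Y) (B : Y → L)
    (D : X → L) : ⨆ y, B y ⊓ zadeh f D y = ⨆ x, B (f x) ⊓ D x := by
  apply le_antisymm
  · refine iSup_le fun y => ?_
    simp only [zadeh, inf_iSup_eq]
    refine iSup₂_le fun x hx => ?_
    subst hx
    exact le_iSup (fun x => B (f x) ⊓ D x) x
  · refine iSup_le fun x => le_iSup_of_le (f x) (inf_le_inf_left _ ?_)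
    exact le_iSup₂_of_le x rfl le_rfl

theorem IsScottContinuous.isDirected_zadeh {L : Type v} [Order.Frame L] {P Q : Type u}
    {E : LOrder L P} {F : LOrder L Q} {f : P → Q} (hf : IsScottContinuous E F f) {D : P → L}
    (hD : E.IsDirected D) : F.IsDirected (zadeh f D) := by
  refine ⟨?_, fun a b => ?_⟩
  · have h := iSup_inf_zadeh f (fun _ => ⊤) D
    simp only [top_inf_eq] at h
    exact h.trans hD.1
  · simp only [zadeh, iSup_inf_eq, inf_iSup_eq]
    refine iSup₂_le fun x hx => iSup₂_le fun y hy => ?_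
    subst hx hy
    refine (hD.2 _ _).trans (iSup_le fun z => ?_)
    refine le_iSup_of_le (f z) (le_iSup₂_of_le z rfl ?_)
    exact inf_le_inf (inf_le_inf_left _ (hf.mono _ _)) (hf.mono _ _)

theorem IsScottContinuous.isContinuousMap {L : Type v} [Order.Frame L] {P Q : Type u}
    {E : LOrder L P} {F : LOrder L Q} {f : P → Q} (hf : IsScottContinuous E F f) :
    IsContinuousMap E.scott F.scott f := by
  intro B hB
  refine ⟨fun x y => (inf_le_inf_left _ (hf.mono x y)).trans (hB.1 _ _), fun D s hD hs => ?_⟩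
  exact (hB.2 _ _ (hf.isDirected_zadeh hD) (hf D s hD hs)).trans (iSup_inf_zadeh f B D)

namespace LTopology

/-! ### The specialization order -/

section

variable {L : Type v} [Order.Frame L] {X : Type u} {T : LTopology L X}

theorem isUpper_specOrder (h : T.IsT0) {A : X → L} (hA : A ∈ T.opens) :
    (T.specOrder h).IsUpper A := by
  intro x y
  rw [inf_comm, ← le_himp_iff]
  exact iInf₂_le A hA

theorem isSup_specOrder (h : T.IsT0) {D : X → L} {s : X}
    (hs : ∀ A ∈ T.opens, A s = ⨆ x, A x ⊓ D x) : (T.specOrder h).IsSup D s := by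
  intro y
  refine eq_of_forall_le_iff fun a => ?_
  rw [le_sub_iff]
  simp only [specOrder, le_iInf_iff, le_himp_iff]
  constructor
  · intro H x A hA
    refine le_trans (le_inf (inf_le_left.trans inf_le_left) ?_) (H A hA)
    rw [hs A hA]
    exact le_iSup_of_le x (le_inf inf_le_right (inf_le_left.trans inf_le_right))
  · intro H A hA
    rw [hs A hA, inf_iSup_eq]
    refine iSup_le fun x => (le_of_eq ?_).trans (H x A hA)
    rw [inf_assoc, inf_comm (D x)]

/-- The join of a directed `L`-subset, computed in the space of points. -/
def pointOfDirected (h : T.IsT0) {D : X → L} (hD : (T.specOrder h).IsDirected D) : T.Point where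
  toFun A := ⨆ x, A.1 x ⊓ D x
  map_inf A B := hD.iSup_inf_inf (isUpper_specOrder h A.2) (isUpper_specOrder h B.2)
  map_sSup S hS := by
    simp only [sSup_apply, iSup_inf_eq]
    exact iSup_comm
  map_const a := by
    rw [← inf_iSup_eq, hD.1, inf_top_eq]

/-- A super-compact `L`-subset `B` induces the point `A ↦ sub(B, A)`. -/
def IsSuperCompact.point {B : X → L} (hB : T.IsSuperCompact B) : T.Point where
  toFun A := sub B A.1
  map_inf A A' := by
    simp only [sub, Pi.inf_apply, himp_inf_distrib, iInf_inf_eq]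
  map_sSup S hS := by
    rw [hB.2 S hS, iSup_subtype]
  map_const a := by
    rw [sub, ← iSup_himp_eq, hB.1, top_himp]

theorem IsSober.exists_apply_eq_iSup (hT : T.IsSober) {D : X → L}
    (hD : (T.specOrder hT.isT0).IsDirected D) :
    ∃ s, ∀ A ∈ T.opens, A s = ⨆ x, A x ⊓ D x := by
  obtain ⟨s, hs⟩ := hT.2 (pointOfDirected hT.isT0 hD)
  exact ⟨s, fun A hA => congrArg (fun p : T.Point => p.toFun ⟨A, hA⟩) hs⟩

theorem IsSober.exists_apply_eq_sub (hT : T.IsSober) {B : X → L} (hB : T.IsSuperCompact B) :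
    ∃ y, ∀ A ∈ T.opens, A y = sub B A := by
  obtain ⟨y, hy⟩ := hT.2 hB.point
  exact ⟨y, fun A hA => congrArg (fun p : T.Point => p.toFun ⟨A, hA⟩) hy⟩

theorem IsSober.isDcpo (hT : T.IsSober) : (T.specOrder hT.isT0).IsDcpo := fun _ hD =>
  let ⟨s, hs⟩ := hT.exists_apply_eq_iSup hD
  ⟨s, isSup_specOrder hT.isT0 hs⟩

/-- Suprema are unique, so any supremum of D is the one supplied by sobriety, at which open sets
commute with the join. -/
theorem IsSober.isScottOpen (hT : T.IsSober) {A : X → L} (hA : A ∈ T.opens) :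
    (T.specOrder hT.isT0).IsScottOpen A := by
  refine ⟨isUpper_specOrder hT.isT0 hA, fun D s hD hs => ?_⟩
  obtain ⟨t, ht⟩ := hT.exists_apply_eq_iSup hD
  rw [hs.unique (isSup_specOrder hT.isT0 ht), ht A hA]

theorem IsLocallySuperCompact.apply_eq_iSup_interior (hl : T.IsLocallySuperCompact)
    (hT : T.IsSober) {A : X → L} (hA : A ∈ T.opens) (x : X) :
    A x = ⨆ y, A y ⊓ T.interior ((T.specOrder hT.isT0).e y) x := by
  apply le_antisymm
  · rw [hl A hA x]
    refine iSup₂_le fun B hB => ?_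
    -- On open sets y stands in for B, and B° ≤ `e y` because sub(B, C) ∧ B z ≤ C z for every open
    -- C.
    obtain ⟨y, hy⟩ := hT.exists_apply_eq_sub hB
    refine le_iSup_of_le y ?_
    rw [hy A hA]
    refine inf_le_inf_left _ (le_interior (T.interior_mem B) (fun z => ?_) x)
    refine le_iInf₂ fun C hC => ?_
    rw [hy C hC, le_himp_iff, inf_comm]
    exact (inf_le_inf_left _ (T.interior_le B z)).trans (sub_inf_le B C z)
  · refine iSup_le fun y => ?_
    exact (inf_le_inf_left _ (T.interior_le _ x)).trans (isUpper_specOrder hT.isT0 hA y x)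

theorem isDirected_interior_and_isSup (hl : T.IsLocallySuperCompact) (hT : T.IsSober) (x : X) :
    (T.specOrder hT.isT0).IsDirected (fun y => T.interior ((T.specOrder hT.isT0).e y) x) ∧
      (T.specOrder hT.isT0).IsSup (fun y => T.interior ((T.specOrder hT.isT0).e y) x) x := by
  refine ⟨⟨?_, fun a b => ?_⟩, isSup_specOrder hT.isT0 fun A hA =>
    hl.apply_eq_iSup_interior hT hA x⟩
  · simpa [IsNonempty] using (hl.apply_eq_iSup_interior hT (T.const_mem ⊤) x).symm
  · refine (hl.apply_eq_iSup_interior hT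
      (T.inf_mem _ (T.interior_mem _) _ (T.interior_mem _)) x).le.trans ?_
    refine iSup_mono fun y => ?_
    rw [inf_comm, inf_assoc]
    exact inf_le_inf_left _ (inf_le_inf (T.interior_le _ y) (T.interior_le _ y))

theorem wayBelow_specOrder (hl : T.IsLocallySuperCompact) (hT : T.IsSober) (x : X) :
    (T.specOrder hT.isT0).wayBelow x =
      fun y => T.interior ((T.specOrder hT.isT0).e y) x := by
  set E := T.specOrder hT.isT0
  obtain ⟨hD, hs⟩ := isDirected_interior_and_isSup hl hT x
  funext y
  apply le_antisymm
  -- The interiors form a directed `L`-subset with supremum x, so y ≪ x can be tested on it; `e y d`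
  -- ∧ (`e d`)° is an open set below `e y`.
  · refine (E.wayBelow_le_of_isSup hD hs y).trans (iSup_le fun d => ?_)
    rw [inf_comm]
    refine le_interior (const_inf_mem (T.interior_mem (E.e d)) (E.e y d)) (fun z => ?_) x
    exact (inf_le_inf_left _ (T.interior_le _ z)).trans (E.trans y d z)
  · refine le_iInf fun D => le_iInf fun s => le_iInf fun hD' => le_iInf fun hs' => ?_
    rw [le_himp_iff]
    -- Conversely, an open set below `e y` is Scott open, so any directed supremum above x meets it
    -- inside D.
    have ho := hT.isScottOpen (T.interior_mem (E.e y))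
    refine (ho.1 x s).trans ((ho.2 D s hD' hs').le.trans (iSup_mono fun d => ?_))
    rw [inf_comm]
    exact inf_le_inf_left _ (T.interior_le _ d)

theorem IsLocallySuperCompact.isContinuous_specOrder (hl : T.IsLocallySuperCompact)
    (hT : T.IsSober) : (T.specOrder hT.isT0).IsContinuous := by
  intro x
  rw [wayBelow_specOrder hl hT x]
  exact isDirected_interior_and_isSup hl hT x

theorem IsLocallySuperCompact.scott_specOrder (hl : T.IsLocallySuperCompact)
    (hT : T.IsSober) : (T.specOrder hT.isT0).scott = T := by
  ext A
  refine ⟨fun hA => ?_, fun hA => hT.isScottOpen hA⟩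
  have h : A = fun x => ⨆ y, A y ⊓ T.interior ((T.specOrder hT.isT0).e y) x := funext fun x => by
    rw [(hl.isContinuous_specOrder hT).apply_eq_iSup hA x, wayBelow_specOrder hl hT x]
  rw [h]
  exact T.iSup_mem fun y => const_inf_mem (T.interior_mem _) _

theorem IsSober.isScottContinuous {Y : Type u} {S : LTopology L Y} (hT : T.IsSober)
    (hS : S.IsSober) {f : X → Y} (hf : IsContinuousMap T S f) :
    IsScottContinuous (T.specOrder hT.isT0) (S.specOrder hS.isT0) f := fun D s hD hs =>
  isSup_specOrder hS.isT0 fun A hA =>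
    ((hT.isScottOpen (hf A hA)).2 D s hD hs).trans (iSup_inf_zadeh f A D).symm

end

end LTopology

/-! ### Equality of objects and morphisms with the same underlying data -/

theorem LSCSob.mk_eq {L : Type v} [Order.Frame L] (X : LSCSob.{u, v} L)
    {T : LTopology L X.carrier} (h : T = X.top) (hl : T.IsLocallySuperCompact)
    (hs : T.IsSober) : (⟨X.carrier, T, hl, hs⟩ : LSCSob.{u, v} L) = X := by
  subst h
  rfl

theorem CDom.mk_eq {L : Type v} [Order.Frame L] (P : CDom.{u, v} L)
    {E : LOrder L P.carrier} (h : E = P.ord) (hd : E.IsDcpo) (hc : E.IsContinuous) :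
    (⟨P.carrier, E, hd, hc⟩ : CDom.{u, v} L) = P := by
  subst h
  rfl

/-- The round trip returns each topology only up to a proved equality, so the hom types differ.
Keeping S and T as variables lets both equations be substituted away. -/
theorem LSCSob.Hom.mk_heq {L : Type v} [Order.Frame L] {X Y : LSCSob.{u, v} L} (f : X ⟶ Y)
    {S : LTopology L X.carrier} {T : LTopology L Y.carrier} (hS : S = X.top) (hT : T = Y.top)
    (hl hs hl' hs') (hf : IsContinuousMap S T f.toFun) :
    HEq (⟨f.toFun, hf⟩ : LSCSob.Hom ⟨X.carrier, S, hl, hs⟩ ⟨Y.carrier, T, hl', hs'⟩) f := by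
  subst hS hT
  rfl

theorem CDom.Hom.mk_heq {L : Type v} [Order.Frame L] {P Q : CDom.{u, v} L} (f : P ⟶ Q)
    {E : LOrder L P.carrier} {F : LOrder L Q.carrier} (hE : E = P.ord) (hF : F = Q.ord)
    (hd hc hd' hc') (hf : IsScottContinuous E F f.toFun) :
    HEq (⟨f.toFun, hf⟩ : CDom.Hom ⟨P.carrier, E, hd, hc⟩ ⟨Q.carrier, F, hd', hc'⟩) f := by
  subst hE hF
  rfl

end LDom

theorem theorem4 (L : Type v) [Order.Frame L] :
    ∃ (hScott : ∀ P : LDom.CDom.{u, v} L,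
        P.ord.scott.IsLocallySuperCompact ∧ P.ord.scott.IsSober)
      (hScottMap : ∀ (P Q : LDom.CDom.{u, v} L) (f : P ⟶ Q),
        LDom.IsContinuousMap P.ord.scott Q.ord.scott f.toFun)
      (hSpec : ∀ X : LDom.LSCSob.{u, v} L, X.spec.IsDcpo ∧ X.spec.IsContinuous)
      (hSpecMap : ∀ (X Y : LDom.LSCSob.{u, v} L) (f : X ⟶ Y),
        LDom.IsScottContinuous X.spec Y.spec f.toFun),
      LDom.specFunctor hSpec hSpecMap ⋙ LDom.scottFunctor hScott hScottMap = 𝟭 (LDom.LSCSob.{u, v} L) ∧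
      LDom.scottFunctor hScott hScottMap ⋙ LDom.specFunctor hSpec hSpecMap = 𝟭 (LDom.CDom.{u, v} L) := by
  refine ⟨fun P => ⟨P.isContinuous.isLocallySuperCompact, P.isContinuous.isSober P.isDcpo⟩,
    fun P Q f => LDom.IsScottContinuous.isContinuousMap f.isScottContinuous,
    fun X => ⟨X.isSober.isDcpo, X.isLocallySuperCompact.isContinuous_specOrder X.isSober⟩,
    fun X Y f => X.isSober.isScottContinuous Y.isSober f.isContinuousMap, ?_, ?_⟩
  · refine CategoryTheory.Functor.hext (fun X => ?_) (fun X Y f => ?_)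
    · exact X.mk_eq (X.isLocallySuperCompact.scott_specOrder X.isSober) _ _
    · exact LDom.LSCSob.Hom.mk_heq f (X.isLocallySuperCompact.scott_specOrder X.isSober)
        (Y.isLocallySuperCompact.scott_specOrder Y.isSober) _ _ _ _ _
  · refine CategoryTheory.Functor.hext (fun P => ?_) (fun P Q f => ?_)
    · exact P.mk_eq (P.isContinuous.specOrder_scott _) _ _
    · exact LDom.CDom.Hom.mk_heq f (P.isContinuous.specOrder_scott _)
        (Q.isContinuous.specOrder_scott _) _ _ _ _ _
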